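/- Let $n$ be a positive integer and let $f\colon\{0,1\}^n\to\{0,1\}$ be a Boolean function. A polynomial in $\mathbb{R}[X_1,\dots,X_n]$ is multilinear if every variable has exponent at most $1$ in each of its monomials. Define: - $D(f)$, the decision tree complexity of $f$: the minimum depth of a deterministic decision tree that queries bits of $x$ and outputs $f(x)$ at a leaf, for every $x\in\{0,1\}^n$; - $\mathrm{sdeg}(f)$, the sign degree of $f$: the minimum degree of a multilinear $p\in\mathbb{R}[X_1,\dots,X_n]$ such that, for all $x\in\{0,1\}^n$, $p(x)\neq 0$, and $p(x)<0$ if and only if $f(x)=1$; - $\mathrm{rdeg}(f)$, the rational degree of $f$: the minimum of $\max(\deg p,\deg q)$ over all multilinear $p,q\in\mathbb{R}[X_1,\dots,X_n]$ such that, for all $x\in\{0,1\}^n$, $q(x)\neq 0$ and $p(x)/q(x)=f(x)$. Then $$D(f)\le 4\,\mathrm{sdeg}(f)^2\,\mathrm{rdeg}(f)^2 .$$ -/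

import Mathlib

noncomputable section

namespace BoolFn

/-- The real number `0` or `1` that a bit stands for. -/
def bit (b : Bool) : ℝ := if b then 1 else 0

/-- The value of the real polynomial `p` at the point `x` of the cube `{0,1}ⁿ`. -/
def evalAt {n : ℕ} (p : MvPolynomial (Fin n) ℝ) (x : Fin n → Bool) : ℝ :=
  MvPolynomial.eval (fun i => bit (x i)) p

/-- `p` is multilinear: every variable has degree at most one in every monomial of `p`. -/
def IsMultilinear {n : ℕ} (p : MvPolynomial (Fin n) ℝ) : Prop :=
  p ∈ MvPolynomial.restrictDegree (Fin n) ℝ 1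

/-- The fraction `p / q` of multilinear polynomials is a rational representation of `f`. -/
def IsRationalRep {n : ℕ} (f : (Fin n → Bool) → Bool) (p q : MvPolynomial (Fin n) ℝ) : Prop :=
  IsMultilinear p ∧ IsMultilinear q ∧
    ∀ x, evalAt q x ≠ 0 ∧ evalAt p x / evalAt q x = bit (f x)

/-- The rational degree of `f`: the minimum of `max (deg p) (deg q)` over all rational
representations `p / q` of `f`. -/
def rdeg {n : ℕ} (f : (Fin n → Bool) → Bool) : ℕ :=
  sInf {d | ∃ p q, IsRationalRep f p q ∧ max p.totalDegree q.totalDegree = d}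

/-- The multilinear polynomial `p` is a sign representation of `f`. -/
def IsSignRep {n : ℕ} (f : (Fin n → Bool) → Bool) (p : MvPolynomial (Fin n) ℝ) : Prop :=
  IsMultilinear p ∧ ∀ x, evalAt p x ≠ 0 ∧ (evalAt p x < 0 ↔ f x = true)

/-- The sign degree of `f`: the minimum degree of a sign representation of `f`. -/
def sdeg {n : ℕ} (f : (Fin n → Bool) → Bool) : ℕ :=
  sInf {d | ∃ p, IsSignRep f p ∧ p.totalDegree = d}

/-- Deterministic decision trees on `n` input bits: a leaf carries an output bit, an inner node
queries bit `i` and continues in `t₀` or `t₁` according to the answer `0` or `1`. -/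
inductive DecisionTree (n : ℕ) : Type
  | leaf (b : Bool) : DecisionTree n
  | query (i : Fin n) (t₀ t₁ : DecisionTree n) : DecisionTree n

namespace DecisionTree

/-- The output of the tree on the input `x`. -/
def output {n : ℕ} : DecisionTree n → (Fin n → Bool) → Bool
  | leaf b, _ => b
  | query i t₀ t₁, x => if x i then t₁.output x else t₀.output x

/-- The depth of the tree: the maximum number of queries on a path from the root to a leaf. -/
def depth {n : ℕ} : DecisionTree n → ℕ
  | leaf _ => 0
  | query _ t₀ t₁ => max t₀.depth t₁.depth + 1

/-- The tree computes `f` exactly on every input. -/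
def Computes {n : ℕ} (T : DecisionTree n) (f : (Fin n → Bool) → Bool) : Prop :=
  ∀ x, T.output x = f x

end DecisionTree

/-- The decision tree complexity of `f`: the minimum depth of a decision tree computing `f`. -/
def D {n : ℕ} (f : (Fin n → Bool) → Bool) : ℕ :=
  sInf {d | ∃ T : DecisionTree n, T.Computes f ∧ T.depth = d}

/-! The three minima are taken over nonempty sets, hence are attained. -/

/-- Every real function on the cube is given by a multilinear polynomial. -/
theorem exists_multilinear {n : ℕ} (g : (Fin n → Bool) → ℝ) :
    ∃ p : MvPolynomial (Fin n) ℝ, IsMultilinear p ∧ ∀ x, evalAt p x = g x := by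
  classical
  have key : ∀ a : Fin n → Bool, ∃ p : MvPolynomial (Fin n) ℝ,
      IsMultilinear p ∧ ∀ x, evalAt p x = if x = a then 1 else 0 := by
    intro a
    refine ⟨∏ i, (if a i then MvPolynomial.X i else 1 - MvPolynomial.X i), ?_, ?_⟩
    · rw [IsMultilinear, MvPolynomial.mem_restrictDegree_iff_sup]
      intro j
      rw [← MvPolynomial.degreeOf_def]
      refine (MvPolynomial.degreeOf_prod_le j _ _).trans ?_
      have hb : ∀ i ∈ (Finset.univ : Finset (Fin n)), MvPolynomial.degreeOf j
          (if a i then MvPolynomial.X i else 1 - MvPolynomial.X i : MvPolynomial (Fin n) ℝ)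
            ≤ if j = i then 1 else 0 := by
        intro i _
        have hX : MvPolynomial.degreeOf j (MvPolynomial.X i : MvPolynomial (Fin n) ℝ)
            ≤ if j = i then 1 else 0 := (MvPolynomial.degreeOf_X (R := ℝ) j i).le
        by_cases h : a i = true
        · simpa [h] using hX
        · simp only [h]
          refine (MvPolynomial.degreeOf_sub_le j _ _).trans (max_le ?_ hX)
          simp [MvPolynomial.degreeOf_one]
      refine (Finset.sum_le_sum hb).trans ?_
      simp
    · intro x
      have hx : evalAt (∏ i, (if a i then MvPolynomial.X i else 1 - MvPolynomial.X i)) x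
          = ∏ i, (if x i = a i then (1 : ℝ) else 0) := by
        rw [evalAt, map_prod]
        refine Finset.prod_congr rfl fun i _ => ?_
        cases h : a i <;> cases h' : x i <;> simp [bit, h']
      rw [hx]
      by_cases h : x = a
      · simp [h]
      · obtain ⟨i, hi⟩ := Function.ne_iff.mp h
        rw [if_neg h]
        exact Finset.prod_eq_zero (Finset.mem_univ i) (if_neg hi)
  choose P hP hP' using key
  refine ⟨∑ a, MvPolynomial.C (g a) * P a, ?_, ?_⟩
  · refine Submodule.sum_mem _ fun a _ => ?_
    rw [← MvPolynomial.smul_eq_C_mul]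
    exact Submodule.smul_mem _ _ (hP a)
  · intro x
    have h : ∀ a, MvPolynomial.eval (fun i => bit (x i)) (P a) = if x = a then 1 else 0 :=
      fun a => hP' a x
    simp [evalAt, map_sum, h]

theorem exists_rdeg {n : ℕ} (f : (Fin n → Bool) → Bool) :
    ∃ p q, IsRationalRep f p q ∧ max p.totalDegree q.totalDegree = rdeg f := by
  obtain ⟨p, hp, hp'⟩ := exists_multilinear fun x => bit (f x)
  obtain ⟨q, hq, hq'⟩ := exists_multilinear fun _ : Fin n → Bool => (1 : ℝ)
  exact Nat.sInf_mem (s := {d | ∃ p q, IsRationalRep f p q ∧ max p.totalDegree q.totalDegree = d})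
    ⟨_, p, q, ⟨hp, hq, fun x => by simp [hp', hq']⟩, rfl⟩

theorem exists_sdeg {n : ℕ} (f : (Fin n → Bool) → Bool) :
    ∃ p, IsSignRep f p ∧ p.totalDegree = sdeg f := by
  obtain ⟨p, hp, hp'⟩ := exists_multilinear fun x => if f x then (-1 : ℝ) else 1
  refine Nat.sInf_mem (s := {d | ∃ p, IsSignRep f p ∧ p.totalDegree = d})
    ⟨_, p, ⟨hp, fun x => ?_⟩, rfl⟩
  rw [hp']
  cases f x <;> norm_num

theorem exists_D {n : ℕ} (f : (Fin n → Bool) → Bool) :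
    ∃ T : DecisionTree n, T.Computes f ∧ T.depth = D f := by
  classical
  have key : ∀ l : List (Fin n), ∀ g : (Fin n → Bool) → Bool,
      (∀ x y, (∀ i ∈ l, x i = y i) → g x = g y) → ∃ T : DecisionTree n, T.Computes g := by
    intro l
    induction l with
    | nil => exact fun g hg => ⟨.leaf (g fun _ => false), fun x => hg _ _ (by simp)⟩
    | cons i l ih =>
      intro g hg
      have hb : ∀ b, ∃ T : DecisionTree n, T.Computes fun x => g (Function.update x i b) := by
        intro b
        refine ih _ fun x y hxy => hg _ _ fun j hj => ?_
        by_cases hji : j = i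
        · subst hji
          simp
        · simpa [hji] using hxy j (by simpa [hji] using hj)
      obtain ⟨T₀, h₀⟩ := hb false
      obtain ⟨T₁, h₁⟩ := hb true
      refine ⟨.query i T₀ T₁, fun x => ?_⟩
      have hu : ∀ b, x i = b → Function.update x i b = x := by
        rintro _ rfl
        exact Function.update_eq_self i x
      cases hx : x i
      · simp [DecisionTree.output, hx, h₀ x, hu _ hx]
      · simp [DecisionTree.output, hx, h₁ x, hu _ hx]
  obtain ⟨T, hT⟩ := key (List.finRange n) f fun x y h => congrArg f (funext fun i => h i (by simp))
  exact Nat.sInf_mem (s := {d | ∃ T : DecisionTree n, T.Computes f ∧ T.depth = d}) ⟨_, T, hT, rfl⟩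

end BoolFn

end

/-! Let `s` be a sign representation of degree `d` and `p / q` a rational representation of degree
`e`. Then `p = f q` and `q - p = (1 - f) q` on the cube, so `p` is nonzero exactly where `f = 1` and
`q - p` exactly where `f = 0`.

Let `x` maximise `|s|`, say with `s x > 0`, and take a maximal disjoint family `F` of top-degree
monomials of `p`. On the subcube through `x` spanned by the variables of one such monomial, `p` is
not identically zero (`exists_ne_zero_of_top_coeff`), so each member of `F` is a block in which a
change of `x` makes `s` negative. Let `r t` be the mean of `s` after changing each block
independently with probability `t`. It has degree at most `d`, satisfies `|r| ≤ r 0 = s x` on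
`[0,1]`, and falls at `0` with slope at least `|F| * s x`; Markov's inequality gives `|F| ≤ 2 d²`
(`card_le_of_isMax`).

By maximality the at most `2 d² e` variables of `F` meet every top monomial of `p`, so querying them
lowers its degree. If `s x < 0`, the same works for `-s` and `q - p`. After at most `2 e` rounds one
of the two polynomials is constant, hence so is `f`. -/

namespace BoolFn

open Finset Polynomial

/-! ### Polynomial functions on the cube -/

/-- The monomial function `x ↦ ∏ i ∈ B, x i` on the cube. -/
def chi {n : ℕ} (B : Finset (Fin n)) (x : Fin n → Bool) : ℝ := ∏ i ∈ B, bit (x i)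

/-- The real functions on the cube given by polynomials of degree at most `d`. -/
def polyLE (n d : ℕ) : Submodule ℝ ((Fin n → Bool) → ℝ) :=
  Submodule.span ℝ (chi '' ((univ.filter fun B : Finset (Fin n) => B.card ≤ d : Finset _) : Set _))

theorem chi_mem_polyLE {n d : ℕ} {B : Finset (Fin n)} (hB : B.card ≤ d) : chi B ∈ polyLE n d :=
  Submodule.subset_span ⟨B, by simpa using hB, rfl⟩

theorem exists_coeff_of_mem_polyLE {n d : ℕ} {g : (Fin n → Bool) → ℝ} (hg : g ∈ polyLE n d) :
    ∃ c : Finset (Fin n) → ℝ, (∀ B, d < B.card → c B = 0) ∧ g = ∑ B, c B • chi B := by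
  rw [polyLE, Submodule.mem_span_image_finset_iff_exists_fun'] at hg
  obtain ⟨c, rfl⟩ := hg
  refine ⟨fun B => if B.card ≤ d then c B else 0, fun B hB => if_neg (by omega), ?_⟩
  rw [sum_filter]
  refine sum_congr rfl fun B _ => ?_
  split_ifs <;> simp_all

/-- Positive powers of a bit equal the bit, so on the cube a monomial depends only on its support,
whose size is at most its degree. -/
theorem evalAt_mem_polyLE {n d : ℕ} (p : MvPolynomial (Fin n) ℝ) (hp : p.totalDegree ≤ d) :
    evalAt p ∈ polyLE n d := by
  have h : evalAt p = ∑ m ∈ p.support, p.coeff m • chi m.support := by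
    funext x
    simp only [evalAt, MvPolynomial.eval_eq, Finset.sum_apply, Pi.smul_apply, smul_eq_mul, chi]
    refine sum_congr rfl fun m _ => congrArg _ (prod_congr rfl fun i hi => ?_)
    have hi : m i ≠ 0 := by simpa using hi
    cases x i <;> simp [bit, hi]
  rw [h]
  refine Submodule.sum_mem _ fun m hm => Submodule.smul_mem _ _ (chi_mem_polyLE ?_)
  refine le_trans ?_ ((MvPolynomial.le_totalDegree hm).trans hp)
  rw [Finsupp.sum, card_eq_sum_ones]
  exact sum_le_sum fun i hi => Nat.one_le_iff_ne_zero.mpr (by simpa using hi)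

theorem eq_of_mem_polyLE_zero {n : ℕ} {g : (Fin n → Bool) → ℝ} (hg : g ∈ polyLE n 0)
    (x y : Fin n → Bool) : g x = g y := by
  obtain ⟨c, hc, rfl⟩ := exists_coeff_of_mem_polyLE hg
  simp only [Finset.sum_apply, Pi.smul_apply]
  refine sum_congr rfl fun B _ => ?_
  rcases B.eq_empty_or_nonempty with rfl | hB
  · simp [chi]
  · simp [hc B hB.card_pos]

theorem chi_piecewise {n : ℕ} (B Q : Finset (Fin n)) (ρ x : Fin n → Bool) :
    chi B (Q.piecewise ρ x) = chi (B ∩ Q) ρ * chi (B \ Q) x := by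
  rw [chi, ← prod_inter_mul_prod_sdiff B Q]
  refine congrArg₂ _ (prod_congr rfl fun i hi => ?_) (prod_congr rfl fun i hi => ?_)
  · rw [piecewise_eq_of_mem _ _ _ (mem_inter.mp hi).2]
  · rw [piecewise_eq_of_notMem _ _ _ (mem_sdiff.mp hi).2]

/-- Fixing the variables in `Q` does not raise the degree; it lowers the degree if `Q` meets every
monomial of top degree. -/
theorem comp_piecewise_mem_polyLE {n d : ℕ} (c : Finset (Fin n) → ℝ) (Q : Finset (Fin n))
    (ρ : Fin n → Bool) (h : ∀ B, c B ≠ 0 → (B \ Q).card ≤ d) :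
    (fun x => (∑ B, c B • chi B : (Fin n → Bool) → ℝ) (Q.piecewise ρ x)) ∈ polyLE n d := by
  have : (fun x => (∑ B, c B • chi B : (Fin n → Bool) → ℝ) (Q.piecewise ρ x))
      = ∑ B, (c B * chi (B ∩ Q) ρ) • chi (B \ Q) := by
    funext x
    simp [Finset.sum_apply, chi_piecewise, mul_assoc]
  rw [this]
  refine Submodule.sum_mem _ fun B _ => ?_
  by_cases hB : c B = 0
  · simp [hB]
  · exact Submodule.smul_mem _ _ (chi_mem_polyLE (h B hB))

theorem restrict_mem_polyLE {n d : ℕ} {g : (Fin n → Bool) → ℝ} (hg : g ∈ polyLE n d)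
    (Q : Finset (Fin n)) (ρ : Fin n → Bool) : (fun x => g (Q.piecewise ρ x)) ∈ polyLE n d := by
  obtain ⟨c, hc, rfl⟩ := exists_coeff_of_mem_polyLE hg
  refine comp_piecewise_mem_polyLE c Q ρ fun B hB => ?_
  by_contra h
  exact hB (hc B (lt_of_lt_of_le (not_le.mp h) (card_le_card sdiff_subset)))

/-- A monomial of top degree is recovered from the values on any subcube spanned by its variables. -/
theorem exists_ne_zero_of_top_coeff {n d : ℕ} (c : Finset (Fin n) → ℝ)
    (hc : ∀ B, d < B.card → c B = 0) {A : Finset (Fin n)} (hA : A.card = d) (hcA : c A ≠ 0)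
    (x : Fin n → Bool) :
    ∃ y : Fin n → Bool, (∀ v, v ∉ A → y v = x v) ∧ (∑ B, c B • chi B : (Fin n → Bool) → ℝ) y ≠ 0 := by
  by_contra! hzero
  let w : Finset (Fin n) → Fin n → Bool := fun T => A.piecewise (fun v => decide (v ∈ T)) x
  have hw : ∀ T, (∑ B, c B • chi B : (Fin n → Bool) → ℝ) (w T) = 0 :=
    fun T => hzero _ fun v hv => by simp [w, hv]
  -- Möbius inversion over the subsets of `A`: the alternating sum isolates `c A`. For each `B` it
  -- factors over `i ∈ A` into `1 + 0` if `i ∈ B` and `1 - 1` otherwise, so only `B ⊇ A` survives; a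
  -- proper superset exceeds the degree bound.
  have hB : ∀ B, ∑ T ∈ A.powerset, (-1 : ℝ) ^ (A \ T).card * (c B * chi B (w T))
      = if B = A then c A else 0 := by
    intro B
    have h1 : ∀ T ∈ A.powerset, (-1 : ℝ) ^ (A \ T).card * (c B * chi B (w T))
        = c B * chi (B \ A) x *
          ((∏ i ∈ T, (1 : ℝ)) * ∏ i ∈ A \ T, (if i ∈ B then (0 : ℝ) else -1)) := by
      intro T hT
      have hT := mem_powerset.mp hT
      have h2 : (-1 : ℝ) ^ (A \ T).card * chi (B ∩ A) (fun v => decide (v ∈ T))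
          = ∏ i ∈ A \ T, (if i ∈ B then (0 : ℝ) else -1) := by
        by_cases hs : ∃ i ∈ A \ T, i ∈ B
        · obtain ⟨i, hi, hiB⟩ := hs
          rw [prod_eq_zero hi (by simp [hiB]), chi,
            prod_eq_zero (mem_inter.mpr ⟨hiB, (mem_sdiff.mp hi).1⟩), mul_zero]
          simp [bit, (mem_sdiff.mp hi).2]
        · push Not at hs
          rw [prod_congr rfl fun i hi => if_neg (hs i hi), prod_const, chi, prod_eq_one, mul_one]
          intro i hi
          have hi := mem_inter.mp hi
          have : i ∈ T := by
            by_contra h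
            exact hs i (mem_sdiff.mpr ⟨hi.2, h⟩) hi.1
          simp [bit, this]
      rw [← h2, chi_piecewise]
      simp only [prod_const_one]
      ring
    rw [sum_congr rfl h1, ← mul_sum, ← prod_add]
    by_cases hAB : A ⊆ B
    · by_cases hBA : B = A
      · subst hBA
        rw [if_pos rfl, prod_eq_one fun i hi => by simp [hi]]
        simp [chi]
      · have : A.card < B.card := card_lt_card (hAB.ssubset_of_ne (Ne.symm hBA))
        rw [hc B (hA ▸ this)]
        simp [hBA]
    · obtain ⟨i, hi, hiB⟩ := not_subset.mp hAB
      rw [prod_eq_zero hi (by simp [hiB]), if_neg (by rintro rfl; exact hiB hi), mul_zero]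
  have : ∑ T ∈ A.powerset, (-1 : ℝ) ^ (A \ T).card *
      (∑ B, c B • chi B : (Fin n → Bool) → ℝ) (w T) = c A := by
    simp only [Finset.sum_apply, Pi.smul_apply, smul_eq_mul, mul_sum]
    rw [sum_comm]
    simp [hB]
  simp [hw] at this
  exact hcA this.symm

/-! ### Markov's inequality and Bernoulli averages -/

/-- Markov's inequality for the derivative at the left endpoint of `[0,1]`. -/
theorem neg_eval_zero_derivative_le {d : ℕ} {r : ℝ[X]} (hd : r.natDegree ≤ d) {M : ℝ} (hM : 0 < M)
    (hr : ∀ t ∈ Set.Icc (0 : ℝ) 1, |r.eval t| ≤ M) :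
    -(derivative r).eval 0 ≤ 2 * d ^ 2 * M := by
  -- The substitution `t = (1 - x) / 2` maps `[-1,1]` onto `[0,1]` and `1` to `0`. Its slope `-1/2`
  -- turns the Chebyshev bound `d²` on the derivative at `1` into `2 d²`.
  set P : ℝ[X] := C M⁻¹ * r.comp (C (1 / 2) * (1 - X)) with hP
  have hlin : (C (1 / 2) * (1 - X) : ℝ[X]).natDegree ≤ 1 := by compute_degree
  have hdeg : P.degree ≤ d := by
    refine degree_le_of_natDegree_le ((natDegree_C_mul_le _ _).trans (natDegree_comp_le.trans ?_))
    calc _ ≤ d * 1 := Nat.mul_le_mul hd hlin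
      _ = d := mul_one d
  have hbnd : ∀ x ∈ Set.Icc (-1 : ℝ) 1, |P.eval x| ≤ 1 := by
    intro x hx
    have := hr (1 / 2 * (1 - x)) ⟨by linarith [hx.2], by linarith [hx.1]⟩
    simp only [hP, eval_mul, eval_C, eval_comp, eval_sub, eval_one, eval_X, abs_mul]
    rw [abs_of_pos (inv_pos.mpr hM)]
    exact (inv_mul_le_one₀ hM).mpr this
  have key := Chebyshev.eval_iterate_derivative_le_of_forall_abs_le_one (k := 1) le_rfl hdeg hbnd
  simp only [Function.iterate_one, Chebyshev.T_derivative_eq_U, eval_mul, Chebyshev.U_eval_one] at key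
  have h1 : (derivative P).eval 1 = M⁻¹ * (-(1 / 2) * (derivative r).eval 0) := by
    simp [hP, derivative_comp]
  rw [h1, inv_mul_le_iff₀ hM] at key
  simp at key
  nlinarith

/-- The expectation of `g S`, as a polynomial in `t`, for a random `S ⊆ F` that contains each
element of `F` independently with probability `t`. -/
noncomputable def bernoulliPoly {ι : Type*} [DecidableEq ι] (F : Finset ι) (g : Finset ι → ℝ) : ℝ[X] :=
  ∑ S ∈ F.powerset, C (g S) * (X ^ S.card * (1 - X) ^ (F \ S).card)

theorem abs_eval_bernoulliPoly_le {ι : Type*} [DecidableEq ι] (F : Finset ι) (g : Finset ι → ℝ)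
    {M : ℝ} (hg : ∀ S, |g S| ≤ M) {t : ℝ} (ht : t ∈ Set.Icc (0 : ℝ) 1) :
    |(bernoulliPoly F g).eval t| ≤ M := by
  have h1 : ∑ S ∈ F.powerset, t ^ S.card * (1 - t) ^ (F \ S).card = 1 := by
    have := prod_add (fun _ => t) (fun _ => 1 - t) F
    simpa using this.symm
  have ht' : 0 ≤ 1 - t := sub_nonneg.mpr ht.2
  have ht0 := ht.1
  rw [bernoulliPoly, eval_finsetSum]
  refine (abs_sum_le_sum_abs _ _).trans ?_
  calc _ ≤ ∑ S ∈ F.powerset, M * (t ^ S.card * (1 - t) ^ (F \ S).card) := by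
        refine sum_le_sum fun S _ => ?_
        have h0 : 0 ≤ t ^ S.card * (1 - t) ^ (F \ S).card := by positivity
        simp only [eval_mul, eval_C, eval_pow, eval_X, eval_sub, eval_one]
        rw [abs_mul, abs_of_nonneg h0]
        exact mul_le_mul_of_nonneg_right (hg S) h0
    _ = M := by rw [← mul_sum, h1, mul_one]

/-- At `t = 0` the weight of `S` has derivative `-|F|` for `S = ∅`, `1` for a singleton and `0` for
larger `S`. The singletons contribute nothing positive by `hg`. -/
theorem eval_zero_derivative_bernoulliPoly_le {ι : Type*} [DecidableEq ι] (F : Finset ι)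
    (g : Finset ι → ℝ) (hg : ∀ i ∈ F, g {i} ≤ 0) :
    (derivative (bernoulliPoly F g)).eval 0 ≤ -(F.card * g ∅) := by
  have h : ∀ S ∈ F.powerset,
      (derivative (C (g S) * (X ^ S.card * (1 - X) ^ (F \ S).card))).eval 0
        ≤ if S = ∅ then -(F.card * g ∅) else 0 := by
    intro S hS
    rcases S.eq_empty_or_nonempty with rfl | hne
    · simp [derivative_pow]
      linarith
    · rw [if_neg hne.ne_empty]
      have hcard := hne.card_pos
      rcases Nat.lt_or_ge 1 S.card with h2 | h1
      · have e1 : S.card ≠ 0 := by omega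
        have e2 : S.card - 1 ≠ 0 := by omega
        simp [derivative_pow, e1, e2]
      · obtain ⟨i, rfl⟩ := card_eq_one.mp (le_antisymm h1 hcard)
        have hi : i ∈ F := mem_powerset.mp hS (mem_singleton_self i)
        simpa [derivative_pow] using hg i hi
  rw [bernoulliPoly, derivative_sum, eval_finsetSum]
  refine (sum_le_sum h).trans ?_
  simp

/-! ### Block flips and the bound on disjoint sign-changing blocks -/

section Blocks

variable {n : ℕ} (x : Fin n → Bool) (y : Finset (Fin n) → Fin n → Bool)

/-- The point `x` with each block `A ∈ S` overwritten by `y A`. -/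
def flipBlocks (S : Finset (Finset (Fin n))) (v : Fin n) : Bool :=
  if ∃ A ∈ S, v ∈ A ∧ y A v ≠ x v then !x v else x v

theorem flipBlocks_empty : flipBlocks x y ∅ = x := by
  funext v
  simp [flipBlocks]

theorem flipBlocks_singleton {A : Finset (Fin n)} (hy : ∀ v, v ∉ A → y A v = x v) :
    flipBlocks x y {A} = y A := by
  funext v
  by_cases hv : v ∈ A
  · cases h1 : x v <;> cases h2 : y A v <;> simp [flipBlocks, hv, h1, h2]
  · simp [flipBlocks, hv, hy v hv]

theorem flipBlocks_of_mem {F S : Finset (Finset (Fin n))}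
    (hF : (F : Set (Finset (Fin n))).PairwiseDisjoint id) (hS : S ⊆ F) {A : Finset (Fin n)}
    (hA : A ∈ F) {v : Fin n} (hv : v ∈ A) :
    flipBlocks x y S v = if A ∈ S then y A v else x v := by
  have huniq : ∀ A' ∈ S, v ∈ A' → A' = A := fun A' hA' hv' =>
    hF.elim_finset (hS hA') hA v hv' hv
  have : (∃ A' ∈ S, v ∈ A' ∧ y A' v ≠ x v) ↔ A ∈ S ∧ y A v ≠ x v := by
    constructor
    · rintro ⟨A', h1, h2, h3⟩
      obtain rfl := huniq A' h1 h2
      exact ⟨h1, h3⟩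
    · rintro ⟨h1, h2⟩
      exact ⟨A, h1, hv, h2⟩
  rw [flipBlocks]
  simp only [this]
  by_cases h1 : A ∈ S <;> cases h2 : x v <;> cases h3 : y A v <;> simp [h1]

theorem flipBlocks_of_notMem {F S : Finset (Finset (Fin n))} (hS : S ⊆ F) {v : Fin n}
    (hv : v ∉ F.biUnion id) : flipBlocks x y S v = x v := by
  refine if_neg ?_
  rintro ⟨A, hA, hvA, -⟩
  exact hv (mem_biUnion.mpr ⟨A, hS hA, hvA⟩)

/-- Disjointness splits the variables of `B` into groups `B ∩ A`, each governed only by whether `A ∈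
S`. This product form lets the expectation of a monomial factor over independent blocks. -/
theorem chi_flipBlocks {F S : Finset (Finset (Fin n))}
    (hF : (F : Set (Finset (Fin n))).PairwiseDisjoint id) (hS : S ⊆ F) (B : Finset (Fin n)) :
    chi B (flipBlocks x y S) = chi (B \ F.biUnion id) x *
      ((∏ A ∈ S, chi (B ∩ A) (y A)) * ∏ A ∈ F \ S, chi (B ∩ A) x) := by
  have hun : B ∩ F.biUnion id = F.biUnion fun A => B ∩ A := by
    ext v
    simp only [mem_inter, mem_biUnion, id]
    tauto
  have hdis : (F : Set (Finset (Fin n))).PairwiseDisjoint fun A => B ∩ A := fun A hA A' hA' hne =>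
    (hF hA hA' hne).mono inter_subset_right inter_subset_right
  have h1 : ∏ v ∈ B \ F.biUnion id, bit (flipBlocks x y S v) = chi (B \ F.biUnion id) x :=
    prod_congr rfl fun v hv => by rw [flipBlocks_of_notMem x y hS (mem_sdiff.mp hv).2]
  have h2 : ∀ A ∈ F, ∏ v ∈ B ∩ A, bit (flipBlocks x y S v)
      = if A ∈ S then chi (B ∩ A) (y A) else chi (B ∩ A) x := by
    intro A hA
    have : ∏ v ∈ B ∩ A, bit (flipBlocks x y S v)
        = ∏ v ∈ B ∩ A, bit (if A ∈ S then y A v else x v) :=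
      prod_congr rfl fun v hv => by
        rw [flipBlocks_of_mem x y hF hS hA (mem_inter.mp hv).2]
    rw [this]
    split_ifs <;> rfl
  rw [chi, ← prod_inter_mul_prod_sdiff B (F.biUnion id), h1, mul_comm, hun, prod_biUnion hdis,
    prod_congr rfl h2, ← prod_sdiff hS, mul_comm (∏ A ∈ F \ S, _)]
  congr 2
  · exact prod_congr rfl fun A hA => if_pos hA
  · exact prod_congr rfl fun A hA => if_neg (mem_sdiff.mp hA).2

/-- By independence the expectation is a product of factors linear in `t`, one per block. A block
missing `B` gives `t + (1 - t) = 1`, so the degree is at most the number of blocks meeting `B`. -/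
theorem natDegree_bernoulliPoly_chi_le {F : Finset (Finset (Fin n))}
    (hF : (F : Set (Finset (Fin n))).PairwiseDisjoint id) (B : Finset (Fin n)) :
    (bernoulliPoly F fun S => chi B (flipBlocks x y S)).natDegree ≤ B.card := by
  have heq : (bernoulliPoly F fun S => chi B (flipBlocks x y S))
      = C (chi (B \ F.biUnion id) x) *
        ∏ A ∈ F, (C (chi (B ∩ A) (y A)) * X + C (chi (B ∩ A) x) * (1 - X)) := by
    rw [prod_add, mul_sum, bernoulliPoly]
    refine sum_congr rfl fun S hS => ?_
    rw [chi_flipBlocks x y hF (mem_powerset.mp hS) B]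
    simp only [map_mul, map_prod, prod_mul_distrib, prod_const]
    ring
  have hfac : ∀ A ∈ F, (C (chi (B ∩ A) (y A)) * X + C (chi (B ∩ A) x) * (1 - X) : ℝ[X]).natDegree
      ≤ (B ∩ A).card := by
    intro A _
    rcases (B ∩ A).eq_empty_or_nonempty with h | h
    · simp [h, chi]
    · refine le_trans ?_ h.card_pos
      compute_degree
  rw [heq]
  refine (natDegree_C_mul_le _ _).trans ((natDegree_prod_le _ _).trans ((sum_le_sum hfac).trans ?_))
  have hdis : ∀ A ∈ F, ∀ A' ∈ F, A ≠ A' → Disjoint (B ∩ A) (B ∩ A') := fun A hA A' hA' hne =>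
    (hF hA hA' hne).mono inter_subset_right inter_subset_right
  rw [← card_biUnion hdis]
  exact card_le_card (biUnion_subset.mpr fun A _ => inter_subset_left)

theorem natDegree_bernoulliPoly_le {d : ℕ} {s : (Fin n → Bool) → ℝ} (hs : s ∈ polyLE n d)
    {F : Finset (Finset (Fin n))} (hF : (F : Set (Finset (Fin n))).PairwiseDisjoint id) :
    (bernoulliPoly F fun S => s (flipBlocks x y S)).natDegree ≤ d := by
  obtain ⟨c, hc, rfl⟩ := exists_coeff_of_mem_polyLE hs
  have : (bernoulliPoly F fun S => (∑ B, c B • chi B : (Fin n → Bool) → ℝ) (flipBlocks x y S))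
      = ∑ B, C (c B) * bernoulliPoly F fun S => chi B (flipBlocks x y S) := by
    simp only [bernoulliPoly, Finset.sum_apply, Pi.smul_apply, smul_eq_mul, map_sum, map_mul,
      sum_mul, mul_sum]
    rw [sum_comm]
    simp only [mul_assoc]
  rw [this]
  refine natDegree_sum_le_of_forall_le _ _ fun B _ => ?_
  by_cases hB : d < B.card
  · simp [hc B hB]
  · exact (natDegree_C_mul_le _ _).trans
      ((natDegree_bernoulliPoly_chi_le x y hF B).trans (not_lt.mp hB))

/-- At a point where `|s|` is maximal, at most `2 d²` disjoint blocks can flip the sign of `s`. -/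
theorem card_le_of_isMax {d : ℕ} {s : (Fin n → Bool) → ℝ} (hs : s ∈ polyLE n d)
    (hmax : ∀ z, |s z| ≤ s x) (hx : 0 < s x) {F : Finset (Finset (Fin n))}
    (hF : (F : Set (Finset (Fin n))).PairwiseDisjoint id)
    (hy : ∀ A ∈ F, ∀ v, v ∉ A → y A v = x v) (hneg : ∀ A ∈ F, s (y A) ≤ 0) :
    F.card ≤ 2 * d ^ 2 := by
  -- For the averaged polynomial `r`, `|F| * s x ≤ -r' 0 ≤ 2 d² * s x`; then `s x > 0` cancels.
  have h1 := neg_eval_zero_derivative_le (natDegree_bernoulliPoly_le x y hs hF) hx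
    fun t ht => abs_eval_bernoulliPoly_le F _ (fun S => hmax (flipBlocks x y S)) ht
  have h2 := eval_zero_derivative_bernoulliPoly_le F (fun S => s (flipBlocks x y S))
    fun A hA => by rw [flipBlocks_singleton x y (hy A hA)]; exact hneg A hA
  rw [flipBlocks_empty] at h2
  have h3 : (F.card : ℝ) * s x ≤ 2 * d ^ 2 * s x := by linarith
  exact_mod_cast le_of_mul_le_mul_right h3 hx

end Blocks

/-! ### Lowering the degree by querying few variables -/

/-- A small set of variables meets all monomials of top degree of `p`. -/
theorem exists_degree_lowering_set {n d a : ℕ} {s p : (Fin n → Bool) → ℝ} (hs : s ∈ polyLE n d)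
    (hp : p ∈ polyLE n (a + 1)) (x : Fin n → Bool) (hmax : ∀ z, |s z| ≤ s x) (hx : 0 < s x)
    (hps : ∀ z, p z ≠ 0 → s z ≤ 0) :
    ∃ Q : Finset (Fin n), Q.card ≤ 2 * d ^ 2 * (a + 1) ∧
      ∀ ρ, (fun z => p (Q.piecewise ρ z)) ∈ polyLE n a := by
  classical
  obtain ⟨c, hc, rfl⟩ := exists_coeff_of_mem_polyLE hp
  let good : Finset (Finset (Finset (Fin n))) := univ.filter fun F =>
    (F : Set (Finset (Fin n))).PairwiseDisjoint id ∧ ∀ A ∈ F, A.card = a + 1 ∧ c A ≠ 0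
  obtain ⟨F, hFgood, hFmax⟩ := good.exists_max_image card ⟨∅, by simp [good]⟩
  obtain ⟨hdis, htop⟩ : (F : Set (Finset (Fin n))).PairwiseDisjoint id ∧
      ∀ A ∈ F, A.card = a + 1 ∧ c A ≠ 0 := by simpa [good] using hFgood
  have hex : ∀ A, ∃ z : Fin n → Bool, A ∈ F →
      (∀ v, v ∉ A → z v = x v) ∧ (∑ B, c B • chi B : (Fin n → Bool) → ℝ) z ≠ 0 := by
    intro A
    by_cases hA : A ∈ F
    · obtain ⟨z, hz⟩ := exists_ne_zero_of_top_coeff c hc (htop A hA).1 (htop A hA).2 x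
      exact ⟨z, fun _ => hz⟩
    · exact ⟨x, fun h => absurd h hA⟩
  choose y hy using hex
  have hcard : F.card ≤ 2 * d ^ 2 := card_le_of_isMax x y hs hmax hx hdis
    (fun A hA => (hy A hA).1) fun A hA => hps _ (hy A hA).2
  refine ⟨F.biUnion id, ?_, fun ρ => comp_piecewise_mem_polyLE c _ ρ fun B hB => ?_⟩
  · exact (card_biUnion_le_card_mul F id (a + 1) fun A hA => (htop A hA).1.le).trans
      (Nat.mul_le_mul_right _ hcard)
  -- A monomial that keeps degree `a + 1` is disjoint from every block. It is nonempty, hence not in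
  -- `F`, and could be added to `F`, against maximality.
  · by_contra! hlt
    have hle : (B \ F.biUnion id).card ≤ B.card := card_le_card sdiff_subset
    have hBle : B.card ≤ a + 1 := by
      by_contra! h
      exact hB (hc B h)
    have hBcard : B.card = a + 1 := by omega
    have hBdis : Disjoint B (F.biUnion id) := by
      rw [← sdiff_eq_left]
      exact eq_of_subset_of_card_le sdiff_subset (by omega)
    have hBF : B ∉ F := by
      intro hBF
      have : B ⊆ F.biUnion id := subset_biUnion_of_mem id hBF
      rw [(disjoint_self_iff_empty B).mp (disjoint_of_subset_right this hBdis)] at hBcard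
      simp at hBcard
    have hins : insert B F ∈ good := by
      simp only [good, mem_filter, mem_univ, true_and, coe_insert, mem_insert]
      refine ⟨hdis.insert fun A hA _ => ?_, ?_⟩
      · exact disjoint_of_subset_right (subset_biUnion_of_mem id hA) hBdis
      · rintro A (rfl | hA)
        · exact ⟨hBcard, hB⟩
        · exact htop A hA
    have := hFmax _ hins
    rw [card_insert_of_notMem hBF] at this
    omega

/-! ### Building the decision tree -/

theorem D_le_depth {n : ℕ} {f : (Fin n → Bool) → Bool} {T : DecisionTree n} (hT : T.Computes f) :
    D f ≤ T.depth :=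
  Nat.sInf_le ⟨T, hT, rfl⟩

theorem D_eq_zero_of_const {n : ℕ} {f : (Fin n → Bool) → Bool} (h : ∀ x y, f x = f y) :
    D f = 0 :=
  Nat.le_zero.mp (D_le_depth (T := .leaf (f fun _ => false)) fun _ => h _ _)

theorem D_le_of_update {n m : ℕ} (f : (Fin n → Bool) → Bool) (i : Fin n)
    (h : ∀ b, D (fun x => f (Function.update x i b)) ≤ m) : D f ≤ m + 1 := by
  obtain ⟨T₀, h₀, d₀⟩ := exists_D fun x => f (Function.update x i false)
  obtain ⟨T₁, h₁, d₁⟩ := exists_D fun x => f (Function.update x i true)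
  have hu : ∀ (x : Fin n → Bool) (b : Bool), x i = b → Function.update x i b = x := by
    rintro x _ rfl
    exact Function.update_eq_self i x
  have hT : (DecisionTree.query i T₀ T₁).Computes f := by
    intro x
    cases hx : x i
    · simp [DecisionTree.output, hx, h₀ x, hu _ _ hx]
    · simp [DecisionTree.output, hx, h₁ x, hu _ _ hx]
  refine (D_le_depth hT).trans ?_
  simp only [DecisionTree.depth, d₀, d₁]
  have := h false
  have := h true
  omega

/-- Querying all variables in `Q` first. -/
theorem D_le_card_add {n m : ℕ} (Q : Finset (Fin n)) (f : (Fin n → Bool) → Bool)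
    (h : ∀ ρ, D (fun x => f (Q.piecewise ρ x)) ≤ m) : D f ≤ Q.card + m := by
  induction Q using Finset.induction_on generalizing f with
  | empty => simpa using h fun _ => false
  | insert i Q hi ih =>
    have : D f ≤ Q.card + m + 1 := by
      refine D_le_of_update f i fun b => ih _ fun ρ => ?_
      have heq : ∀ x, Function.update (Q.piecewise ρ x) i b
          = (insert i Q).piecewise (Function.update ρ i b) x := by
        intro x
        funext v
        by_cases hv : v = i
        · subst hv
          simp
        · by_cases hvQ : v ∈ Q <;> simp [hv, hvQ]
      simpa only [heq] using h (Function.update ρ i b)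
    rw [card_insert_of_notMem hi]
    omega

/-- The decision tree that repeatedly queries a set of variables meeting all monomials of top
degree of `p` or of `q`. -/
theorem D_le_of_reps {n d e : ℕ} (N : ℕ) : ∀ (a b : ℕ) (f : (Fin n → Bool) → Bool)
    (s p q : (Fin n → Bool) → ℝ), a ≤ e → b ≤ e → a + b ≤ N →
    s ∈ polyLE n d → p ∈ polyLE n a → q ∈ polyLE n b →
    (∀ x, s x ≠ 0 ∧ (s x < 0 ↔ f x = true)) → (∀ x, p x ≠ 0 ↔ f x = true) →
    (∀ x, q x ≠ 0 ↔ f x = false) → D f ≤ N * (2 * d ^ 2 * e) := by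
  induction N with
  | zero =>
    intro a b f s p q _ _ hab _ hp _ _ hpf _
    obtain rfl : a = 0 := by omega
    have : ∀ x y, f x = f y := fun x y =>
      -- A `p` of degree `0` is constant, and `f` is determined by whether `p` vanishes.
      Bool.eq_iff_iff.mpr (by rw [← hpf, ← hpf, eq_of_mem_polyLE_zero hp x y])
    simp [D_eq_zero_of_const this]
  | succ N ih =>
    intro a b f s p q ha hb hab hs hp hq hsf hpf hqf
    rcases a with _ | a
    · have : ∀ x y, f x = f y := fun x y =>
        Bool.eq_iff_iff.mpr (by rw [← hpf, ← hpf, eq_of_mem_polyLE_zero hp x y])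
      simp [D_eq_zero_of_const this]
    rcases b with _ | b
    · have : ∀ x y, f x = f y := fun x y => by
        have h : f x = false ↔ f y = false := by
          rw [← hqf, ← hqf, eq_of_mem_polyLE_zero hq x y]
        cases hx : f x <;> cases hy : f y <;> simp_all
      simp [D_eq_zero_of_const this]
    -- One round costs at most `2 d² e` queries: `e` bounds the degrees in every round, while `N`
    -- bounds their sum and hence the number of rounds left.
    have step : ∀ Q : Finset (Fin n), Q.card ≤ 2 * d ^ 2 * e →
        (∀ ρ, D (fun x => f (Q.piecewise ρ x)) ≤ N * (2 * d ^ 2 * e)) →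
        D f ≤ (N + 1) * (2 * d ^ 2 * e) := by
      intro Q hQ h
      have := D_le_card_add Q f h
      rw [add_mul, one_mul]
      omega
    obtain ⟨x, -, hx⟩ := (univ : Finset (Fin n → Bool)).exists_max_image (fun z => |s z|)
      univ_nonempty
    -- The sign of `s` at the maximiser decides which polynomial is attacked: it must be the one
    -- whose nonzeros force the opposite sign.
    rcases lt_or_gt_of_ne (hsf x).1 with hneg | hpos
    · obtain ⟨Q, hQ, hQq⟩ := exists_degree_lowering_set (Submodule.neg_mem _ hs) hq x
        (fun z => by simpa [abs_of_neg hneg] using hx z (mem_univ z)) (by simpa using hneg)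
        (fun z hz => by
          have h1 : ¬ s z < 0 := by rw [(hsf z).2, (hqf z).mp hz]; simp
          simpa using h1)
      refine step Q (hQ.trans (Nat.mul_le_mul_left _ hb)) fun ρ => ?_
      exact ih (a + 1) b _ _ _ _ ha (by omega) (by omega) (restrict_mem_polyLE hs Q ρ)
        (restrict_mem_polyLE hp Q ρ) (hQq ρ) (fun _ => hsf _) (fun _ => hpf _) fun _ => hqf _
    · obtain ⟨Q, hQ, hQp⟩ := exists_degree_lowering_set hs hp x
        (fun z => by simpa [abs_of_pos hpos] using hx z (mem_univ z)) hpos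
        (fun z hz => ((hsf z).2.mpr ((hpf z).mp hz)).le)
      refine step Q (hQ.trans (Nat.mul_le_mul_left _ ha)) fun ρ => ?_
      exact ih a (b + 1) _ _ _ _ (by omega) hb (by omega) (restrict_mem_polyLE hs Q ρ)
        (hQp ρ) (restrict_mem_polyLE hq Q ρ) (fun _ => hsf _) (fun _ => hpf _) fun _ => hqf _

end BoolFn

theorem mainTheorem3 (n : ℕ) (f : (Fin n → Bool) → Bool) :
    BoolFn.D f ≤ 4 * BoolFn.sdeg f ^ 2 * BoolFn.rdeg f ^ 2 := by
  obtain ⟨s, ⟨-, hs⟩, hsd⟩ := BoolFn.exists_sdeg f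
  obtain ⟨p, q, ⟨-, -, hpq⟩, hd⟩ := BoolFn.exists_rdeg f
  have hp := BoolFn.evalAt_mem_polyLE p (hd ▸ le_max_left _ _)
  have hq := BoolFn.evalAt_mem_polyLE q (hd ▸ le_max_right _ _)
  -- The certificate for `f = 0` is `q - p`, of degree at most `rdeg f`. The degree sum allows `2 *
  -- rdeg f` rounds, which yields the constant `4`.
  have key := BoolFn.D_le_of_reps (BoolFn.rdeg f + BoolFn.rdeg f) _ _ f (BoolFn.evalAt s)
    (BoolFn.evalAt p) (BoolFn.evalAt q - BoolFn.evalAt p) le_rfl le_rfl le_rfl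
    (BoolFn.evalAt_mem_polyLE s hsd.le) hp (Submodule.sub_mem _ hq hp) hs
    (fun x => by
      obtain ⟨h0, h⟩ := hpq x
      rw [div_eq_iff h0] at h
      cases hf : f x <;> simp [h, hf, BoolFn.bit, h0])
    (fun x => by
      obtain ⟨h0, h⟩ := hpq x
      rw [div_eq_iff h0] at h
      cases hf : f x <;> simp [h, hf, BoolFn.bit, h0])
  refine key.trans (le_of_eq ?_)
  ring
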